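/- Let $n\ge 2$. An $n$-edge arm in $\mathbb{R}^3$, up to translation, is a list of edge vectors $(e_1,\dots,e_n)\in\mathscr{A}_3(n)=(\mathbb{R}^3)^n=\mathbb{R}^{3n}$, and the closed polygon space is the codimension-3 linear subspace $\mathscr{P}_3(n)=\{e\in\mathscr{A}_3(n): e_1+\dots+e_n=0\}$. The Hopf-Gaussian measure $\mathrm{H}$ on $\mathscr{A}_3(n)$ is the pushforward of the standard Gaussian measure on $\mathbb{H}^n=\mathbb{R}^{4n}$ under the coordinatewise Hopf map $(q_1,\dots,q_n)\mapsto(\bar q_1\mathbf{i}q_1,\dots,\bar q_n\mathbf{i}q_n)$, where the imaginary quaternions are identified with $\mathbb{R}^3$. Then $\mathrm{H}$ has a unique continuous density $p:\mathscr{A}_3(n)\to[0,\infty]$ with respect to Lebesgue measure on $\mathbb{R}^{3n}$, and the end-to-end vector $e_1+\dots+e_n$ has, under $\mathrm{H}$, a unique continuous density $G_n:\mathbb{R}^3\to[0,\infty]$ with respect to Lebesgue measure on $\mathbb{R}^3$ (the Green's function). The codimension-3 Hausdorff measure of $\mathscr{P}_3(n)$ in $\mathscr{A}_3(n)$, that is,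 the total mass $$C_n=\int_{\mathscr{A}_3(n)} p(e)\,\delta(e_1+\dots+e_n)\,de_1\cdots de_n=\frac1{J}\int_{\mathscr{P}_3(n)}p\,d\mathcal{H}^{3n-3},$$ where $\mathcal{H}^{3n-3}$ is the Euclidean Hausdorff measure normalized to agree with Lebesgue measure, $S:\mathbb{R}^{3n}\to\mathbb{R}^3$ is the map $S(e)=e_1+\dots+e_n$, and $J=\sqrt{\det(SS^{\mathsf T})}=n^{3/2}$ is its normal Jacobian, is equal to the value of the Green's function at the origin, and $$C_n=G_n(0)=\frac{\Gamma(n-\tfrac32)}{64\,\pi^{3/2}\,\Gamma(n)}.$$ -/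

import Mathlib

open MeasureTheory ProbabilityTheory
open scoped ENNReal Quaternion

noncomputable section

namespace HopfGaussian

/-- Euclidean three-space. -/
abbrev E3 : Type := EuclideanSpace ℝ (Fin 3)

/-- The space of `n`-edge polygonal arms in `ℝ³` up to translation: lists of `n` edge vectors,
with the Euclidean metric of `ℝ³ⁿ`. -/
abbrev Arm (n : ℕ) : Type := PiLp 2 (fun _ : Fin n => E3)

/-- The end-to-end (failure-to-close) vector of an arm: the sum of its edges. -/
def endToEnd (n : ℕ) : Arm n →ₗ[ℝ] E3 where
  toFun e := ∑ i, e i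
  map_add' x y := by simp [Finset.sum_add_distrib]
  map_smul' c x := by simp [Finset.smul_sum]

/-- The space of closed `n`-gons in `ℝ³` up to translation, the arms whose edges sum to zero:
a linear subspace of codimension 3 (for `n ≥ 1`). -/
def closedPolygons (n : ℕ) : Submodule ℝ (Arm n) := LinearMap.ker (endToEnd n)

/-- The Hopf map `q ↦ q̄ i q` from the quaternions to the imaginary quaternions,
identified with `ℝ³`. -/
def hopf (q : ℍ[ℝ]) : E3 :=
  let w : ℍ[ℝ] := star q * ⟨0, 1, 0, 0⟩ * q
  !₂[w.imI, w.imJ, w.imK]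

/-- The standard Gaussian measure on `ℍⁿ = ℝ⁴ⁿ`, in real coordinates. -/
def gaussianH (n : ℕ) : Measure (Fin n → Fin 4 → ℝ) :=
  Measure.pi fun _ => Measure.pi fun _ => gaussianReal 0 1

/-- The coordinatewise Hopf map `ℍⁿ → ℝ³ⁿ`, with `ℍⁿ` written in real coordinates. -/
def hopfArm (n : ℕ) (x : Fin n → Fin 4 → ℝ) : Arm n :=
  WithLp.toLp 2 fun i => hopf ⟨x i 0, x i 1, x i 2, x i 3⟩

/-- The Hopf-Gaussian measure on the space of `n`-edge arms in `ℝ³`. -/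
def hopfGaussian (n : ℕ) : Measure (Arm n) := (gaussianH n).map (hopfArm n)

/-- `p` is a continuous density, with values in `[0, ∞]`, of `μ` with respect to Lebesgue measure.
The value `∞` is allowed because the density of one edge of a Hopf-Gaussian arm has a pole at the
origin. A continuous density is determined at every point, not only almost everywhere. -/
def IsContinuousDensity {E : Type*} [TopologicalSpace E] [MeasureSpace E]
    (μ : Measure E) (p : E → ℝ≥0∞) : Prop :=
  Continuous p ∧ μ = (volume : Measure E).withDensity p

/-- `G` is the Green's function of `n`-edge Hopf-Gaussian arms: the continuous probability density
of the end-to-end vector. -/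
def IsGreenFunction (n : ℕ) (G : E3 → ℝ≥0∞) : Prop :=
  IsContinuousDensity ((hopfGaussian n).map (endToEnd n)) G

/-- The normal Jacobian `√det (S S†)` of a linear map `S` of Euclidean spaces. -/
def normalJacobian {E F : Type*} [NormedAddCommGroup E] [InnerProductSpace ℝ E]
    [FiniteDimensional ℝ E] [NormedAddCommGroup F] [InnerProductSpace ℝ F]
    [FiniteDimensional ℝ F] (S : E →ₗ[ℝ] F) : ℝ :=
  Real.sqrt (LinearMap.det (S ∘ₗ LinearMap.adjoint S))

/-- The codimension-3 measure `p(e) δ(e₁ + ⋯ + eₙ) de₁ ⋯ deₙ` which a density `p` on the space of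
arms induces on the space of closed polygons: `p` times the `(3n-3)`-dimensional Euclidean Hausdorff
measure of the subspace, divided by the normal Jacobian of the closure map `e ↦ e₁ + ⋯ + eₙ`
(this is what the delta function of a surjective linear map means). -/
def codimThreeMeasure (n : ℕ) (p : Arm n → ℝ≥0∞) : Measure (Arm n) :=
  (ENNReal.ofReal (normalJacobian (endToEnd n)))⁻¹ •
    (((Measure.euclideanHausdorffMeasure (3 * n - 3) : Measure (Arm n)).restrict
      (closedPolygons n : Set (Arm n))).withDensity p)

end HopfGaussian

end

namespace HopfGaussian

/-! The law of one edge is a Gaussian mixture: draw a time `t` from the unit exponential law, then a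
centred Gaussian vector of covariance `8t`. Both this mixture and the Hopf image of a Gaussian
quaternion have characteristic function `1 / (1 + 4‖k‖²)`, so they agree (`map_hopf_gaussian`). An
arm is therefore governed by independent times `t i`, given which its density is a product of heat
kernels.

The coarea formula for the linear end-to-end map writes Lebesgue measure on arms as an integral over
its fibres, with the factor `1/J`. On each fibre the product of heat kernels integrates to the heat
kernel at time `∑ t i` (`lintegral_closedPolygons_prod_heat`). Averaging over the times shows that
the fibre integral of the arm density is `green n`, which is thus the density of the end-to-end
vector; its fibre over `0` is the closed polygon space, which gives `C_n = G_n(0)`.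

At the origin the heat kernel is `(16πt)^(-3/2)`, so the value is `(16π)^(-3/2)` times the moment of
order `-3/2` of a sum of `n` exponential variables, namely `Γ(n - 3/2)/Γ(n)`. Radial monotonicity of
the heat kernel yields continuity of the densities, and continuity yields uniqueness. -/

/-! ### Product measures and Lebesgue measure on arms. -/

theorem lintegral_pi_prod {α : Type*} [MeasurableSpace α] (μ : Measure α) [SigmaFinite μ] {n : ℕ}
    {f : Fin n → α → ℝ≥0∞} (hf : ∀ i, Measurable (f i)) :
    ∫⁻ x : Fin n → α, ∏ i, f i (x i) ∂(Measure.pi fun _ => μ) = ∏ i, ∫⁻ a, f i a ∂μ := by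
  induction n with
  | zero => simp
  | succ n ih =>
    have hm : Measurable fun x : Fin n → α => ∏ i, f i.succ (x i) :=
      Finset.measurable_prod _ fun i _ => (hf i.succ).comp (measurable_pi_apply i)
    rw [← ((measurePreserving_piFinSuccAbove (fun _ : Fin (n + 1) => μ) 0).symm).lintegral_comp_emb
      (MeasurableEquiv.measurableEmbedding _)]
    simp_rw [Fin.prod_univ_succ]
    simp only [MeasurableEquiv.piFinSuccAbove_symm_apply, Fin.insertNthEquiv_apply,
      Fin.insertNth_zero', Fin.cons_zero, Fin.cons_succ]
    rw [lintegral_prod_mul (hf 0).aemeasurable hm.aemeasurable, ih fun i => hf i.succ]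

theorem pi_withDensity {α : Type*} [MeasurableSpace α] (μ : Measure α) [SigmaFinite μ] {n : ℕ}
    {f : α → ℝ≥0∞} (hf : Measurable f) [SigmaFinite (μ.withDensity f)] :
    (Measure.pi fun _ : Fin n => μ.withDensity f) =
      (Measure.pi fun _ : Fin n => μ).withDensity fun x => ∏ i, f (x i) := by
  refine Measure.pi_eq fun s hs => ?_
  rw [withDensity_apply _ (MeasurableSet.univ_pi hs), ← lintegral_indicator (MeasurableSet.univ_pi hs)]
  have : ((Set.univ.pi s).indicator fun x : Fin n → α => ∏ i, f (x i)) =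
      fun x => ∏ i, (s i).indicator f (x i) := by
    ext x
    by_cases hx : x ∈ Set.univ.pi s
    · rw [Set.indicator_of_mem hx]
      exact Finset.prod_congr rfl fun i _ => (Set.indicator_of_mem (hx i trivial) _).symm
    · rw [Set.indicator_of_notMem hx]
      simp only [Set.mem_pi, Set.mem_univ, true_implies, not_forall] at hx
      obtain ⟨i, hi⟩ := hx
      exact (Finset.prod_eq_zero (Finset.mem_univ i) (Set.indicator_of_notMem hi _)).symm
  rw [this, lintegral_pi_prod μ fun i => hf.indicator (hs i)]
  exact Finset.prod_congr rfl fun i _ => by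
    rw [lintegral_indicator (hs i), withDensity_apply _ (hs i)]

theorem lintegral_exp_neg_mul_sq_norm {V : Type*} [NormedAddCommGroup V] [InnerProductSpace ℝ V]
    [FiniteDimensional ℝ V] [MeasurableSpace V] [BorelSpace V] {b : ℝ} (hb : 0 < b) :
    ∫⁻ v : V, ENNReal.ofReal (Real.exp (-b * ‖v‖ ^ 2)) =
      ENNReal.ofReal ((Real.pi / b) ^ (Module.finrank ℝ V / 2 : ℝ)) := by
  rw [← GaussianFourier.integral_rexp_neg_mul_sq_norm hb, ofReal_integral_eq_lintegral_ofReal]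
  · apply Integrable.of_integral_ne_zero
    rw [GaussianFourier.integral_rexp_neg_mul_sq_norm hb]
    positivity
  · exact ae_of_all _ fun _ => by positivity

/-- Both measures are Haar, hence proportional. The Gaussian `exp (-π‖e‖²)` has integral one in
every dimension and factors over the edges, so the constant is one. -/
theorem measurePreserving_toLp_arm (n : ℕ) :
    MeasurePreserving (WithLp.toLp 2 : (Fin n → E3) → Arm n)
      (Measure.pi fun _ => volume) volume := by
  have hmeas : Measurable (WithLp.toLp 2 : (Fin n → E3) → Arm n) :=
    (MeasurableEquiv.toLp 2 (Fin n → E3)).measurable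
  refine ⟨hmeas, ?_⟩
  let L := (PiLp.continuousLinearEquiv 2 ℝ (fun _ : Fin n => E3)).symm
  have : ((Measure.pi fun _ : Fin n => (volume : Measure E3)).map L).IsAddHaarMeasure :=
    L.isAddHaarMeasure_map _
  have key := Measure.isAddLeftInvariant_eq_smul
    ((Measure.pi fun _ : Fin n => (volume : Measure E3)).map L) (volume : Measure (Arm n))
  set c := Measure.addHaarScalarFactor
    ((Measure.pi fun _ : Fin n => (volume : Measure E3)).map L) (volume : Measure (Arm n))
  have hL : (L : (Fin n → E3) → Arm n) = WithLp.toLp 2 := rfl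
  rw [hL] at key
  have hc : (c : ℝ≥0∞) = 1 := by
    have h1 : ∫⁻ e : Arm n, ENNReal.ofReal (Real.exp (-Real.pi * ‖e‖ ^ 2)) = 1 := by
      rw [lintegral_exp_neg_mul_sq_norm Real.pi_pos, div_self Real.pi_ne_zero]; simp
    have h3 : ∫⁻ e : E3, ENNReal.ofReal (Real.exp (-Real.pi * ‖e‖ ^ 2)) = 1 := by
      rw [lintegral_exp_neg_mul_sq_norm Real.pi_pos, div_self Real.pi_ne_zero]; simp
    have h2 : ∫⁻ e, ENNReal.ofReal (Real.exp (-Real.pi * ‖e‖ ^ 2))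
        ∂((Measure.pi fun _ : Fin n => (volume : Measure E3)).map
          (WithLp.toLp 2 : (Fin n → E3) → Arm n)) = 1 := by
      rw [lintegral_map (by fun_prop) hmeas]
      have : ∀ x : Fin n → E3, ENNReal.ofReal (Real.exp (-Real.pi * ‖(WithLp.toLp 2 x : Arm n)‖ ^ 2))
          = ∏ i, ENNReal.ofReal (Real.exp (-Real.pi * ‖x i‖ ^ 2)) := by
        intro x
        rw [← ENNReal.ofReal_prod_of_nonneg (fun _ _ => by positivity), ← Real.exp_sum,
          ← Finset.mul_sum, PiLp.norm_sq_eq_of_L2]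
      simp_rw [this]
      rw [lintegral_pi_prod (f := fun _ x => ENNReal.ofReal (Real.exp (-Real.pi * ‖x‖ ^ 2))) volume
        (fun i => by fun_prop)]
      simp only [h3, Finset.prod_const_one]
    rw [key, lintegral_smul_measure, h1] at h2
    simpa [ENNReal.smul_def] using h2
  rw [key]
  have : c = 1 := by exact_mod_cast hc
  rw [this, one_smul]

theorem lintegral_arm_prod {n : ℕ} {f : Fin n → E3 → ℝ≥0∞} (hf : ∀ i, Measurable (f i)) :
    ∫⁻ e : Arm n, ∏ i, f i (e i) = ∏ i, ∫⁻ x, f i x := by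
  rw [← (measurePreserving_toLp_arm n).lintegral_comp_emb
    (MeasurableEquiv.toLp 2 (Fin n → E3)).measurableEmbedding]
  exact lintegral_pi_prod volume hf

/-! ### Gamma integrals and the exponential law. -/

theorem lintegral_rpow_mul_exp_neg_mul {a r : ℝ} (ha : 0 < a) (hr : 0 < r) :
    ∫⁻ t in Set.Ioi (0 : ℝ), ENNReal.ofReal (t ^ (a - 1) * Real.exp (-(r * t))) =
      ENNReal.ofReal (Real.Gamma a * r ^ (-a)) := by
  have h := Real.integral_rpow_mul_exp_neg_mul_Ioi ha hr
  have hG := Real.Gamma_pos_of_pos ha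
  rw [← ofReal_integral_eq_lintegral_ofReal, h]
  · rw [one_div, Real.inv_rpow hr.le, Real.rpow_neg hr.le, mul_comm]
  · exact Integrable.of_integral_ne_zero (by rw [h]; positivity)
  · filter_upwards [ae_restrict_mem measurableSet_Ioi] with t ht
    have : (0 : ℝ) < t := ht
    positivity

/-- The unit-rate exponential law. -/
noncomputable def expLaw : Measure ℝ :=
  (volume.restrict (Set.Ioi 0)).withDensity fun t => ENNReal.ofReal (Real.exp (-t))

theorem lintegral_expLaw {f : ℝ → ℝ≥0∞} (hf : Measurable f) :
    ∫⁻ t, f t ∂expLaw = ∫⁻ t in Set.Ioi 0, ENNReal.ofReal (Real.exp (-t)) * f t := by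
  rw [expLaw, lintegral_withDensity_eq_lintegral_mul _ (by fun_prop) hf]
  rfl

theorem lintegral_exp_neg_mul_expLaw {u : ℝ} (hu : 0 ≤ u) :
    ∫⁻ t, ENNReal.ofReal (Real.exp (-(u * t))) ∂expLaw = ENNReal.ofReal ((1 + u)⁻¹) := by
  rw [lintegral_expLaw (by fun_prop)]
  have := lintegral_rpow_mul_exp_neg_mul one_pos (show 0 < 1 + u by linarith)
  simp only [sub_self, Real.rpow_zero, one_mul, Real.Gamma_one, Real.rpow_neg_one] at this
  rw [← this]
  refine lintegral_congr fun t => ?_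
  rw [← ENNReal.ofReal_mul (by positivity), ← Real.exp_add]
  ring_nf

instance : IsProbabilityMeasure expLaw := ⟨by
  simpa using lintegral_exp_neg_mul_expLaw (le_refl 0)⟩

theorem ae_expLaw_pos : ∀ᵐ t ∂expLaw, 0 < t :=
  (withDensity_absolutelyContinuous _ _).ae_le (ae_restrict_mem measurableSet_Ioi)

theorem ae_pi_expLaw_pos (n : ℕ) :
    ∀ᵐ t ∂(Measure.pi fun _ : Fin n => expLaw), ∀ i, 0 < t i :=
  ae_all_iff.2 fun i => (Measure.tendsto_eval_ae_ae (i := i)).eventually ae_expLaw_pos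

/-! ### Heat kernels and their exponential mixture. -/

/-- The density at `y ∈ ℝ³` of the centred Gaussian law with covariance `8t` times the identity. -/
noncomputable def heat (t : ℝ) (y : E3) : ℝ :=
  (16 * Real.pi * t) ^ (-(3 / 2) : ℝ) * Real.exp (-(16 * t)⁻¹ * ‖y‖ ^ 2)

theorem measurable_heat : Measurable fun q : ℝ × E3 => heat q.1 q.2 := by
  unfold heat; fun_prop

theorem heat_nonneg {t : ℝ} (ht : 0 < t) (y : E3) : 0 ≤ heat t y := by
  unfold heat; positivity

theorem heat_pos {t : ℝ} (ht : 0 < t) (y : E3) : 0 < heat t y := by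
  unfold heat; positivity

theorem lintegral_heat {t : ℝ} (ht : 0 < t) : ∫⁻ y, ENNReal.ofReal (heat t y) = 1 := by
  unfold heat
  simp_rw [ENNReal.ofReal_mul (show (0 : ℝ) ≤ (16 * Real.pi * t) ^ (-(3 / 2) : ℝ) by positivity)]
  rw [lintegral_const_mul _ (by fun_prop), lintegral_exp_neg_mul_sq_norm (by positivity),
    ← ENNReal.ofReal_mul (by positivity)]
  have : Real.pi / (16 * t)⁻¹ = 16 * Real.pi * t := by field_simp
  rw [this, finrank_euclideanSpace_fin, ← Real.rpow_add (by positivity)]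
  norm_num

/-- The Fourier transform of the Gaussian density. -/
theorem integral_cexp_inner_mul_heat {t : ℝ} (ht : 0 < t) (k : E3) :
    ∫ y : E3, (heat t y : ℂ) * Complex.exp (inner ℝ y k * Complex.I) =
      Complex.exp (-(4 * t * ‖k‖ ^ 2)) := by
  have h := GaussianFourier.integral_cexp_neg_mul_sq_norm_add
    (b := (((16 * t)⁻¹ : ℝ) : ℂ)) (by rw [Complex.ofReal_re]; positivity) Complex.I k
  have e1 : ∀ y : E3, (heat t y : ℂ) * Complex.exp (inner ℝ y k * Complex.I) =
      (((16 * Real.pi * t) ^ (-(3 / 2) : ℝ) : ℝ) : ℂ) *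
        Complex.exp (-(((16 * t)⁻¹ : ℝ) : ℂ) * ‖y‖ ^ 2 + Complex.I * inner ℝ k y) := by
    intro y
    rw [heat, Complex.ofReal_mul, mul_assoc, Complex.ofReal_exp, ← Complex.exp_add,
      real_inner_comm k y]
    push_cast
    ring_nf
  simp_rw [e1]
  rw [integral_const_mul, h, finrank_euclideanSpace_fin, ← mul_assoc]
  have e2 : (Real.pi / (((16 * t)⁻¹ : ℝ) : ℂ)) ^ (((3 : ℕ) : ℂ) / 2) =
      (((16 * Real.pi * t) ^ (3 / 2 : ℝ) : ℝ) : ℂ) := by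
    rw [Complex.ofReal_cpow (by positivity)]
    congr 1
    · push_cast
      have : (t : ℂ) ≠ 0 := by exact_mod_cast ht.ne'
      field_simp
    · push_cast; rfl
  rw [e2, ← Complex.ofReal_mul, ← Real.rpow_add (by positivity)]
  norm_num
  have : (t : ℂ) ≠ 0 := by exact_mod_cast ht.ne'
  congr 1
  field_simp
  norm_num

/-- The density of one edge of a Hopf-Gaussian arm. -/
noncomputable def edgeDensity (x : E3) : ℝ≥0∞ := ∫⁻ t, ENNReal.ofReal (heat t x) ∂expLaw

theorem measurable_ofReal_heat :
    Measurable fun q : ℝ × E3 => ENNReal.ofReal (heat q.1 q.2) :=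
  measurable_heat.ennreal_ofReal

theorem measurable_edgeDensity : Measurable edgeDensity :=
  measurable_ofReal_heat.lintegral_prod_left'

theorem lintegral_edgeDensity_mul {f : E3 → ℝ≥0∞} (hf : Measurable f) :
    ∫⁻ x, edgeDensity x * f x = ∫⁻ t, (∫⁻ x, ENNReal.ofReal (heat t x) * f x) ∂expLaw := by
  rw [lintegral_lintegral_swap]
  · refine lintegral_congr fun x => ?_
    rw [edgeDensity, lintegral_mul_const]
    exact measurable_ofReal_heat.comp (measurable_id.prodMk measurable_const)
  · exact (measurable_ofReal_heat.mul (hf.comp measurable_snd)).aemeasurable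

instance : IsProbabilityMeasure ((volume : Measure E3).withDensity edgeDensity) := ⟨by
  rw [withDensity_apply _ MeasurableSet.univ, setLIntegral_univ]
  have := lintegral_edgeDensity_mul (f := 1) measurable_one
  simp only [Pi.one_apply, mul_one] at this
  rw [this]
  have : ∀ᵐ t ∂expLaw, ∫⁻ x, ENNReal.ofReal (heat t x) = 1 := by
    filter_upwards [ae_expLaw_pos] with t ht using lintegral_heat ht
  rw [lintegral_congr_ae this]
  simp⟩

theorem integral_exp_neg_mul_expLaw {u : ℝ} (hu : 0 ≤ u) :
    ∫ t, Real.exp (-(u * t)) ∂expLaw = (1 + u)⁻¹ := by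
  rw [integral_eq_lintegral_of_nonneg_ae (ae_of_all _ fun _ => by positivity) (by fun_prop),
    lintegral_exp_neg_mul_expLaw hu, ENNReal.toReal_ofReal (by positivity)]

/-- Given the time `t` the characteristic function is `exp (-4t‖k‖²)`; averaging over `t` is a
Laplace transform of the exponential law. -/
theorem charFun_edgeDensity (k : E3) :
    charFun ((volume : Measure E3).withDensity edgeDensity) k = ((1 + 4 * ‖k‖ ^ 2 : ℝ) : ℂ)⁻¹ := by
  -- The joint law of time and edge. Its density is finite everywhere, whereas `edgeDensity` has a
  -- pole, so complex integrals can be unfolded here.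
  let M : Measure (ℝ × E3) :=
    (expLaw.prod volume).withDensity fun q => ENNReal.ofReal (heat q.1 q.2)
  have hM : (volume : Measure E3).withDensity edgeDensity = M.map Prod.snd := by
    ext s hs
    rw [Measure.map_apply measurable_snd hs, withDensity_apply _ hs,
      withDensity_apply _ (measurable_snd hs), ← lintegral_indicator hs,
      ← lintegral_indicator (measurable_snd hs)]
    have := lintegral_edgeDensity_mul (f := s.indicator 1) (measurable_one.indicator hs)
    have h1 : ∀ x, edgeDensity x * s.indicator 1 x = s.indicator edgeDensity x := fun x => by
      by_cases hx : x ∈ s <;> simp [hx]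
    simp_rw [h1] at this
    rw [this, lintegral_prod _ ((measurable_ofReal_heat.indicator (measurable_snd hs)).aemeasurable)]
    refine lintegral_congr fun t => lintegral_congr fun x => ?_
    by_cases hx : x ∈ s <;> simp [hx, Set.indicator]
  have hMfin : IsFiniteMeasure M := by
    have : M Set.univ = 1 := by
      rw [← Set.preimage_univ (f := (Prod.snd : ℝ × E3 → E3)),
        ← Measure.map_apply measurable_snd MeasurableSet.univ, ← hM]
      exact measure_univ
    exact ⟨by rw [this]; exact ENNReal.one_lt_top⟩
  have hmeas : Measurable fun q : ℝ × E3 => Complex.exp (inner ℝ q.2 k * Complex.I) := by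
    fun_prop
  have hint : Integrable (fun q : ℝ × E3 => Complex.exp (inner ℝ q.2 k * Complex.I)) M :=
    Integrable.of_bound hmeas.aestronglyMeasurable 1
      (ae_of_all _ fun q => (Complex.norm_exp_ofReal_mul_I _).le)
  have hint' := (integrable_withDensity_iff_integrable_smul' measurable_ofReal_heat
    (ae_of_all _ fun _ => ENNReal.ofReal_lt_top)).1 hint
  rw [charFun_apply, hM, integral_map measurable_snd.aemeasurable (by fun_prop),
    integral_withDensity_eq_integral_toReal_smul measurable_ofReal_heat
      (ae_of_all _ fun _ => ENNReal.ofReal_lt_top), integral_prod _ hint']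
  have h2 : ∀ᵐ t ∂expLaw, ∫ x : E3, (ENNReal.ofReal (heat t x)).toReal •
      Complex.exp (inner ℝ x k * Complex.I) = ((Real.exp (-(4 * ‖k‖ ^ 2 * t)) : ℝ) : ℂ) := by
    filter_upwards [ae_expLaw_pos] with t ht
    simp_rw [ENNReal.toReal_ofReal (heat_nonneg ht _), Complex.real_smul]
    rw [integral_cexp_inner_mul_heat ht]
    push_cast
    ring_nf
  rw [integral_congr_ae h2, integral_complex_ofReal, integral_exp_neg_mul_expLaw (by positivity)]
  push_cast
  rfl

/-! ### The characteristic function of the Hopf image of a Gaussian. -/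

theorem integral_cexp_quadratic_gaussianReal {s : ℂ} (hs : 0 < s.re) (c : ℂ) :
    ∫ x : ℝ, Complex.exp ((1 - s) / 2 * x ^ 2 + c * x) ∂(gaussianReal 0 1) =
      (((√(2 * Real.pi))⁻¹ : ℝ) : ℂ) * (2 * Real.pi / s) ^ (1 / 2 : ℂ) *
        Complex.exp (c ^ 2 / (2 * s)) := by
  have hs0 : s ≠ 0 := by rintro rfl; simp at hs
  rw [integral_gaussianReal_eq_integral_smul one_ne_zero]
  have h := integral_cexp_quadratic (b := -s / 2) (by simp; linarith) c 0
  have e : ∀ x : ℝ, gaussianPDFReal 0 1 x • Complex.exp ((1 - s) / 2 * x ^ 2 + c * x) =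
      (((√(2 * Real.pi))⁻¹ : ℝ) : ℂ) * Complex.exp (-s / 2 * x ^ 2 + c * x + 0) := by
    intro x
    rw [gaussianPDFReal, Complex.real_smul, Complex.ofReal_mul, Complex.ofReal_exp, mul_assoc,
      ← Complex.exp_add]
    push_cast
    simp only [mul_one]
    ring_nf
  simp_rw [e]
  rw [integral_const_mul, h, mul_assoc]
  congr 3
  · field_simp
  · field_simp
    ring

/-- Pairing two variables with the same `s` squares the complex square root, so no branch remains.
-/
theorem integral_cexp_quadratic_mul_gaussianReal {s : ℂ} (hs : 0 < s.re) (c d : ℂ) :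
    (∫ x : ℝ, Complex.exp ((1 - s) / 2 * x ^ 2 + c * x) ∂(gaussianReal 0 1)) *
      (∫ x : ℝ, Complex.exp ((1 - s) / 2 * x ^ 2 + d * x) ∂(gaussianReal 0 1)) =
      s⁻¹ * Complex.exp ((c ^ 2 + d ^ 2) / (2 * s)) := by
  have hs0 : s ≠ 0 := by rintro rfl; simp at hs
  have hpi : (Real.pi : ℂ) ≠ 0 := by exact_mod_cast Real.pi_ne_zero
  rw [integral_cexp_quadratic_gaussianReal hs, integral_cexp_quadratic_gaussianReal hs, add_div,
    Complex.exp_add]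
  have h1 : ((((√(2 * Real.pi))⁻¹ : ℝ) : ℂ)) ^ 2 = (2 * Real.pi : ℂ)⁻¹ := by
    rw [← Complex.ofReal_pow, inv_pow, Real.sq_sqrt (by positivity)]
    push_cast; rfl
  have h2 : ((2 * Real.pi / s : ℂ) ^ (1 / 2 : ℂ)) ^ 2 = 2 * Real.pi / s := by
    rw [one_div]; exact Complex.cpow_nat_inv_pow _ two_ne_zero
  have h3 : (2 * Real.pi : ℂ)⁻¹ * (2 * Real.pi) = 1 := by field_simp
  linear_combination ((2 * Real.pi / s : ℂ) ^ (1 / 2 : ℂ)) ^ 2 *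
      Complex.exp (c ^ 2 / (2 * s)) * Complex.exp (d ^ 2 / (2 * s)) * h1 +
    (2 * Real.pi : ℂ)⁻¹ * Complex.exp (c ^ 2 / (2 * s)) * Complex.exp (d ^ 2 / (2 * s)) * h2 +
    s⁻¹ * Complex.exp (c ^ 2 / (2 * s)) * Complex.exp (d ^ 2 / (2 * s)) * h3

theorem hopf_eq (w x y z : ℝ) : hopf ⟨w, x, y, z⟩ =
    !₂[w ^ 2 + x ^ 2 - y ^ 2 - z ^ 2, 2 * (x * y - w * z), 2 * (x * z + w * y)] := by
  have h1 : star (⟨w, x, y, z⟩ : ℍ[ℝ]) = ⟨w, -x, -y, -z⟩ := by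
    ext <;> simp
  have h2 : (⟨w, -x, -y, -z⟩ : ℍ[ℝ]) * ⟨0, 1, 0, 0⟩ = ⟨x, w, -z, y⟩ := by
    ext <;> simp
  have h3 : star (⟨w, x, y, z⟩ : ℍ[ℝ]) * ⟨0, 1, 0, 0⟩ * ⟨w, x, y, z⟩ =
      ⟨0, w ^ 2 + x ^ 2 - y ^ 2 - z ^ 2, 2 * (x * y - w * z), 2 * (x * z + w * y)⟩ := by
    rw [h1, h2]
    ext <;> simp <;> ring
  change !₂[(star (⟨w, x, y, z⟩ : ℍ[ℝ]) * ⟨0, 1, 0, 0⟩ * ⟨w, x, y, z⟩).imI,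
    (star (⟨w, x, y, z⟩ : ℍ[ℝ]) * ⟨0, 1, 0, 0⟩ * ⟨w, x, y, z⟩).imJ,
    (star (⟨w, x, y, z⟩ : ℍ[ℝ]) * ⟨0, 1, 0, 0⟩ * ⟨w, x, y, z⟩).imK] = _
  rw [h3]

/-- Arranged for integrating out `w` and `x` first: they do not interact, and enter with the same
square coefficient and linear terms in `y, z`. -/
theorem inner_hopf (w x y z : ℝ) (k : E3) :
    inner ℝ (hopf ⟨w, x, y, z⟩) k = k 0 * (w ^ 2 + x ^ 2 - y ^ 2 - z ^ 2) +
      w * (2 * (y * k 2 - z * k 1)) + x * (2 * (y * k 1 + z * k 2)) := by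
  simp [hopf_eq, PiLp.inner_apply, Fin.sum_univ_three]
  ring

theorem map_gaussianReal_prod_vec (μ : Measure ℝ) [IsProbabilityMeasure μ] :
    ((μ.prod μ).prod (μ.prod μ)).map
      (fun q => (![q.2.1, q.2.2, q.1.1, q.1.2] : Fin 4 → ℝ)) = Measure.pi fun _ => μ := by
  symm
  refine Measure.pi_eq fun s hs => ?_
  rw [Measure.map_apply (by fun_prop) (MeasurableSet.univ_pi hs)]
  have : (fun q : (ℝ × ℝ) × (ℝ × ℝ) => (![q.2.1, q.2.2, q.1.1, q.1.2] : Fin 4 → ℝ)) ⁻¹'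
      Set.univ.pi s = (s 2 ×ˢ s 3) ×ˢ (s 0 ×ˢ s 1) := by
    ext q
    simp [Fin.forall_fin_succ]
    tauto
  rw [this, Measure.prod_prod, Measure.prod_prod, Measure.prod_prod, Fin.prod_univ_four]
  ring

theorem measurable_hopf_coord : Measurable fun x : Fin 4 → ℝ => hopf ⟨x 0, x 1, x 2, x 3⟩ := by
  simp_rw [hopf_eq]
  refine (MeasurableEquiv.toLp 2 (Fin 3 → ℝ)).measurable.comp (measurable_pi_lambda _ fun i => ?_)
  fin_cases i <;> simp <;> fun_prop

theorem integral_cexp_inner_hopf (k : E3) :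
    ∫ q : (ℝ × ℝ) × (ℝ × ℝ),
      Complex.exp (inner ℝ (hopf ⟨q.2.1, q.2.2, q.1.1, q.1.2⟩) k * Complex.I)
      ∂(((gaussianReal 0 1).prod (gaussianReal 0 1)).prod
        ((gaussianReal 0 1).prod (gaussianReal 0 1))) = ((1 + 4 * ‖k‖ ^ 2 : ℝ) : ℂ)⁻¹ := by
  have hint : Integrable (fun q : (ℝ × ℝ) × (ℝ × ℝ) =>
      Complex.exp (inner ℝ (hopf ⟨q.2.1, q.2.2, q.1.1, q.1.2⟩) k * Complex.I))
      (((gaussianReal 0 1).prod (gaussianReal 0 1)).prod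
        ((gaussianReal 0 1).prod (gaussianReal 0 1))) := by
    refine Integrable.of_bound ?_ 1 (ae_of_all _ fun q => (Complex.norm_exp_ofReal_mul_I _).le)
    simp_rw [inner_hopf]
    fun_prop
  rw [integral_prod _ hint]
  let s : ℂ := 1 - 2 * k 0 * Complex.I
  have hsre : s.re = 1 := by simp [s]
  have hs0 : s ≠ 0 := fun h => by rw [h] at hsre; simp at hsre
  -- Integrating out the first pair leaves a form in `y² + z²` with parameter `1 + 2 i k₀ + 4 (k₁² +
  -- k₂²) / s`, which equals this because `(1 + 2 i k₀) s = 1 + 4 k₀²`. The answer is then `1 / (s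
  -- s')`.
  let s' : ℂ := ((1 + 4 * ‖k‖ ^ 2 : ℝ) : ℂ) * s⁻¹
  have hs're : 0 < s'.re := by
    rw [Complex.re_ofReal_mul, Complex.inv_re, hsre]
    have := Complex.normSq_pos.2 hs0
    positivity
  have hk : (‖k‖ ^ 2 : ℝ) = k 0 ^ 2 + k 1 ^ 2 + k 2 ^ 2 := by
    rw [PiLp.norm_sq_eq_of_L2, Fin.sum_univ_three]; simp
  have hinner : ∀ p : ℝ × ℝ, ∫ q : ℝ × ℝ,
      Complex.exp (inner ℝ (hopf ⟨q.1, q.2, p.1, p.2⟩) k * Complex.I)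
        ∂((gaussianReal 0 1).prod (gaussianReal 0 1)) =
      s⁻¹ * (Complex.exp ((1 - s') / 2 * p.1 ^ 2 + 0 * p.1) *
        Complex.exp ((1 - s') / 2 * p.2 ^ 2 + 0 * p.2)) := by
    rintro ⟨y, z⟩
    let c : ℂ := 2 * (y * k 2 - z * k 1) * Complex.I
    let d : ℂ := 2 * (y * k 1 + z * k 2) * Complex.I
    have e : ∀ q : ℝ × ℝ, Complex.exp (inner ℝ (hopf ⟨q.1, q.2, y, z⟩) k * Complex.I) =
        Complex.exp (-(k 0 * (y ^ 2 + z ^ 2)) * Complex.I) *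
          (Complex.exp ((1 - s) / 2 * q.1 ^ 2 + c * q.1) *
            Complex.exp ((1 - s) / 2 * q.2 ^ 2 + d * q.2)) := by
      intro q
      rw [← Complex.exp_add, ← Complex.exp_add, inner_hopf]
      congr 1
      simp only [s, c, d]
      push_cast
      ring
    simp_rw [e]
    rw [integral_const_mul, integral_prod_mul (fun w : ℝ => Complex.exp ((1 - s) / 2 * w ^ 2 + c * w))
      (fun w : ℝ => Complex.exp ((1 - s) / 2 * w ^ 2 + d * w)),
      integral_cexp_quadratic_mul_gaussianReal (by rw [hsre]; exact one_pos), mul_left_comm,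
      ← Complex.exp_add, ← Complex.exp_add]
    congr 2
    have hI := Complex.I_sq
    simp only [s', c, d, hk]
    push_cast
    field_simp
    simp only [s]
    ring_nf
    simp only [hI]
    ring
  simp_rw [hinner]
  rw [integral_const_mul, integral_prod_mul (fun w : ℝ => Complex.exp ((1 - s') / 2 * w ^ 2 + 0 * w))
      (fun w : ℝ => Complex.exp ((1 - s') / 2 * w ^ 2 + 0 * w)),
    integral_cexp_quadratic_mul_gaussianReal hs're]
  simp only [s', mul_inv, inv_inv]
  simp
  field_simp

/-- The law of one edge of a Hopf-Gaussian arm. -/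
theorem map_hopf_gaussian :
    (Measure.pi fun _ : Fin 4 => gaussianReal 0 1).map
      (fun x => hopf ⟨x 0, x 1, x 2, x 3⟩) = (volume : Measure E3).withDensity edgeDensity := by
  have : IsProbabilityMeasure ((Measure.pi fun _ : Fin 4 => gaussianReal 0 1).map
      (fun x => hopf ⟨x 0, x 1, x 2, x 3⟩)) :=
    Measure.isProbabilityMeasure_map measurable_hopf_coord.aemeasurable
  refine Measure.ext_of_charFun (funext fun k => ?_)
  rw [charFun_edgeDensity, charFun_apply,
    integral_map measurable_hopf_coord.aemeasurable (by fun_prop),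
    ← map_gaussianReal_prod_vec, integral_map (by fun_prop), ← integral_cexp_inner_hopf k]
  · rfl
  · have := measurable_hopf_coord
    exact (by fun_prop : Measurable fun x : Fin 4 → ℝ =>
      Complex.exp (inner ℝ (hopf ⟨x 0, x 1, x 2, x 3⟩) k * Complex.I)).aestronglyMeasurable

/-! ### The density on the arm space. -/

/-- The density of the Hopf-Gaussian measure on `n`-edge arms. -/
noncomputable def armDensity (n : ℕ) (e : Arm n) : ℝ≥0∞ := ∏ i, edgeDensity (e i)

theorem measurable_eval (n : ℕ) (i : Fin n) : Measurable fun e : Arm n => e i :=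
  (measurable_pi_apply i).comp (MeasurableEquiv.toLp 2 (Fin n → E3)).symm.measurable

theorem measurable_armDensity (n : ℕ) : Measurable (armDensity n) :=
  Finset.measurable_prod _ fun i _ => measurable_edgeDensity.comp (measurable_eval n i)

theorem measurable_hopfArm (n : ℕ) : Measurable (hopfArm n) :=
  (MeasurableEquiv.toLp 2 (Fin n → E3)).measurable.comp
    (measurable_pi_lambda _ fun i => measurable_hopf_coord.comp (measurable_pi_apply i))

theorem hopfGaussian_eq_withDensity (n : ℕ) :
    hopfGaussian n = (volume : Measure (Arm n)).withDensity (armDensity n) := by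
  have htoLp : Measurable (WithLp.toLp 2 : (Fin n → E3) → Arm n) :=
    (MeasurableEquiv.toLp 2 (Fin n → E3)).measurable
  have hsf : SigmaFinite ((Measure.pi fun _ : Fin 4 => gaussianReal 0 1).map
      (fun x => hopf ⟨x 0, x 1, x 2, x 3⟩)) := by
    rw [map_hopf_gaussian]; infer_instance
  have h1 : hopfGaussian n =
      ((gaussianH n).map fun x i => hopf ⟨x i 0, x i 1, x i 2, x i 3⟩).map (WithLp.toLp 2) := by
    exact (Measure.map_map htoLp
      (measurable_pi_lambda _ fun i => measurable_hopf_coord.comp (measurable_pi_apply i))).symm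
  have h2 : (gaussianH n).map (fun x i => hopf ⟨x i 0, x i 1, x i 2, x i 3⟩) =
      (Measure.pi fun _ : Fin n => (volume : Measure E3)).withDensity
        fun x => ∏ i, edgeDensity (x i) := by
    rw [gaussianH, Measure.pi_map_pi (f := fun _ (x : Fin 4 → ℝ) => hopf ⟨x 0, x 1, x 2, x 3⟩)
      (fun _ => measurable_hopf_coord.aemeasurable), map_hopf_gaussian,
      pi_withDensity _ measurable_edgeDensity]
  rw [h1, h2]
  ext s hs
  rw [Measure.map_apply htoLp hs, withDensity_apply _ (htoLp hs), withDensity_apply _ hs,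
    ← (measurePreserving_toLp_arm n).setLIntegral_comp_preimage hs (measurable_armDensity n)]
  rfl

/-! ### Linear algebra of the end-to-end map. -/

/-- The arm all of whose edges equal a given vector. -/
def diag (n : ℕ) : E3 →ₗ[ℝ] Arm n where
  toFun y := WithLp.toLp 2 fun _ => y
  map_add' _ _ := rfl
  map_smul' _ _ := rfl

@[simp] theorem diag_apply (n : ℕ) (y : E3) (i : Fin n) : diag n y i = y := rfl

theorem endToEnd_apply (n : ℕ) (e : Arm n) : endToEnd n e = ∑ i, e i := rfl

theorem mem_closedPolygons {n : ℕ} {e : Arm n} : e ∈ closedPolygons n ↔ ∑ i, e i = 0 := Iff.rfl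

theorem inner_diag {n : ℕ} (e : Arm n) (y : E3) :
    inner ℝ e (diag n y) = inner ℝ (endToEnd n e) y := by
  simp [PiLp.inner_apply, endToEnd_apply, sum_inner]

theorem endToEnd_diag (n : ℕ) (y : E3) : endToEnd n (diag n y) = (n : ℝ) • y := by
  simp [endToEnd_apply, Nat.cast_smul_eq_nsmul]

theorem norm_diag_sq (n : ℕ) (y : E3) : ‖diag n y‖ ^ 2 = n * ‖y‖ ^ 2 := by
  simp [PiLp.norm_sq_eq_of_L2]

theorem normalJacobian_endToEnd (n : ℕ) :
    normalJacobian (endToEnd n) = (n : ℝ) ^ (3 / 2 : ℝ) := by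
  have h : endToEnd n ∘ₗ LinearMap.adjoint (endToEnd n) = (n : ℝ) • LinearMap.id := by
    have : LinearMap.adjoint (endToEnd n) = diag n :=
      ((LinearMap.eq_adjoint_iff _ _).2 fun y e => by
        rw [real_inner_comm, inner_diag, real_inner_comm]).symm
    rw [this]
    ext1 y
    simpa using endToEnd_diag n y
  rw [normalJacobian, h, LinearMap.det_smul, LinearMap.det_id, mul_one, finrank_euclideanSpace_fin,
    Real.sqrt_eq_rpow, ← Real.rpow_natCast, ← Real.rpow_mul (Nat.cast_nonneg n)]
  norm_num

theorem finrank_arm (n : ℕ) : Module.finrank ℝ (Arm n) = 3 * n := by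
  rw [(WithLp.linearEquiv 2 ℝ (Fin n → E3)).finrank_eq, Module.finrank_pi_fintype]
  simp [mul_comm]

theorem finrank_closedPolygons {n : ℕ} (hn : 1 ≤ n) :
    Module.finrank ℝ (closedPolygons n) + 3 = 3 * n := by
  have h := LinearMap.finrank_range_add_finrank_ker (endToEnd n)
  have hs : LinearMap.range (endToEnd n) = ⊤ := by
    refine LinearMap.range_eq_top.2 fun y => ⟨diag n ((n : ℝ)⁻¹ • y), ?_⟩
    rw [endToEnd_diag, smul_smul, mul_inv_cancel₀ (by positivity), one_smul]
  rw [hs, finrank_top, finrank_euclideanSpace_fin, finrank_arm] at h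
  change 3 + Module.finrank ℝ (closedPolygons n) = 3 * n at h
  omega

/-! ### Integration over fibres. -/

theorem map_subtype_euclideanHausdorffMeasure {V : Type*} [NormedAddCommGroup V]
    [InnerProductSpace ℝ V] [MeasurableSpace V] [BorelSpace V] (K : Submodule ℝ V) (d : ℕ) :
    (Measure.euclideanHausdorffMeasure d : Measure K).map Subtype.val =
      (Measure.euclideanHausdorffMeasure d : Measure V).restrict (K : Set V) := by
  rw [isometry_subtype_coe.map_euclideanHausdorffMeasure, Subtype.range_coe]

theorem sigmaFinite_euclideanHausdorffMeasure {V : Type*} [NormedAddCommGroup V]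
    [InnerProductSpace ℝ V] [FiniteDimensional ℝ V] [MeasurableSpace V] [BorelSpace V]
    (K : Submodule ℝ V) : SigmaFinite
      (Measure.euclideanHausdorffMeasure (Module.finrank ℝ K) : Measure K) := by
  rw [InnerProductSpace.euclideanHausdorffMeasure_eq_volume]
  infer_instance

/-- Integration over an orthogonal direct sum. -/
theorem lintegral_eq_lintegral_lintegral_orthogonal {V F : Type*}
    [NormedAddCommGroup V] [InnerProductSpace ℝ V] [FiniteDimensional ℝ V] [MeasurableSpace V]
    [BorelSpace V] [NormedAddCommGroup F] [InnerProductSpace ℝ F] [FiniteDimensional ℝ F]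
    [MeasurableSpace F] [BorelSpace F] (K : Submodule ℝ V) (ι : F →ₗᵢ[ℝ] V)
    (hι : ∀ w ∈ K, ∀ y, inner ℝ w (ι y) = 0)
    (hdim : Module.finrank ℝ K + Module.finrank ℝ F = Module.finrank ℝ V)
    {f : V → ℝ≥0∞} (hf : Measurable f) :
    ∫⁻ v, f v = ∫⁻ y : F, (∫⁻ w : K, f (w + ι y)
      ∂(Measure.euclideanHausdorffMeasure (Module.finrank ℝ K))) := by
  rw [InnerProductSpace.euclideanHausdorffMeasure_eq_volume]
  let : MeasureSpace K := measureSpaceOfInnerProductSpace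
  let L : WithLp 2 (K × F) →ₗᵢ[ℝ] V :=
    { toLinearMap := (K.subtype ∘ₗ LinearMap.fst ℝ _ _ + ι.toLinearMap ∘ₗ LinearMap.snd ℝ _ _) ∘ₗ
        (WithLp.linearEquiv 2 ℝ _).toLinearMap
      norm_map' := fun q => by
        rw [← sq_eq_sq₀ (norm_nonneg _) (norm_nonneg _), WithLp.prod_norm_sq_eq_of_L2]
        change ‖(q.fst : V) + ι q.snd‖ ^ 2 = _
        rw [norm_add_sq_real, hι _ q.fst.2, ι.norm_map]
        simp }
  let Φ : WithLp 2 (K × F) ≃ₗᵢ[ℝ] V := L.toLinearIsometryEquiv (by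
    rw [(WithLp.linearEquiv 2 ℝ (K × F)).finrank_eq, Module.finrank_prod, hdim])
  have hF : Measurable fun q : K × F => f (q.1 + ι q.2) :=
    hf.comp ((measurable_subtype_coe.comp measurable_fst).add
      (ι.continuous.measurable.comp measurable_snd))
  have hfΦ : Measurable fun q : WithLp 2 (K × F) => f (Φ q) := hf.comp Φ.continuous.measurable
  rw [← Φ.measurePreserving.lintegral_comp hf,
    ← (WithLp.volume_preserving_toLp K F).lintegral_comp hfΦ]
  exact lintegral_prod_symm (fun q : K × F => f (q.1 + ι q.2)) hF.aemeasurable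

/-- The isometric embedding of `ℝ³` as the space of constant arms. -/
noncomputable def diagIsometry {n : ℕ} (hn : 1 ≤ n) : E3 →ₗᵢ[ℝ] Arm n where
  toLinearMap := (√n)⁻¹ • diag n
  norm_map' y := by
    have hn' : (0 : ℝ) < n := by exact_mod_cast hn
    rw [← sq_eq_sq₀ (norm_nonneg _) (norm_nonneg _)]
    change ‖(√n)⁻¹ • diag n y‖ ^ 2 = _
    rw [norm_smul, mul_pow, norm_diag_sq, Real.norm_eq_abs, sq_abs, inv_pow, Real.sq_sqrt hn'.le,
      inv_mul_cancel_left₀ hn'.ne']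

theorem diagIsometry_apply {n : ℕ} (hn : 1 ≤ n) (y : E3) :
    diagIsometry hn y = diag n ((√n)⁻¹ • y) := ((diag n).map_smul _ _).symm

theorem lintegral_comp_smul_of_pos {c : ℝ} (hc : 0 < c) {g : E3 → ℝ≥0∞} (hg : Measurable g) :
    ∫⁻ y : E3, g (c • y) = ENNReal.ofReal ((c ^ 3)⁻¹) * ∫⁻ y, g y := by
  rw [← lintegral_map hg (measurable_const_smul c), Measure.map_addHaar_smul _ hc.ne',
    lintegral_smul_measure, finrank_euclideanSpace_fin, abs_of_pos (by positivity), smul_eq_mul]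

theorem measurable_diag (n : ℕ) : Measurable (diag n) :=
  (MeasurableEquiv.toLp 2 (Fin n → E3)).measurable.comp (measurable_pi_lambda _ fun _ => measurable_id)

/-- The coarea formula for the end-to-end map. -/
theorem lintegral_arm_eq_lintegral_closedPolygons {n : ℕ} (hn : 1 ≤ n) {f : Arm n → ℝ≥0∞}
    (hf : Measurable f) :
    ∫⁻ e, f e = (ENNReal.ofReal (normalJacobian (endToEnd n)))⁻¹ *
      ∫⁻ y : E3, (∫⁻ w : closedPolygons n, f (w + diag n ((n : ℝ)⁻¹ • y))
        ∂(Measure.euclideanHausdorffMeasure (3 * n - 3))) := by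
  have hn' : (0 : ℝ) < n := by exact_mod_cast hn
  have hdim := finrank_closedPolygons hn
  have hdim' : Module.finrank ℝ (closedPolygons n) = 3 * n - 3 := by omega
  have hsf : SFinite (Measure.euclideanHausdorffMeasure (3 * n - 3) :
      Measure (closedPolygons n)) := by
    rw [← hdim']
    have := sigmaFinite_euclideanHausdorffMeasure (closedPolygons n)
    infer_instance
  have hF : Measurable fun q : closedPolygons n × E3 => f (q.1 + diag n q.2) :=
    hf.comp ((measurable_subtype_coe.comp measurable_fst).add
      ((measurable_diag n).comp measurable_snd))
  let g : E3 → ℝ≥0∞ := fun y => ∫⁻ w : closedPolygons n, f (w + diag n y)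
    ∂(Measure.euclideanHausdorffMeasure (3 * n - 3))
  have hg : Measurable g := hF.lintegral_prod_left'
  have hs : 0 < √(n : ℝ) := Real.sqrt_pos.2 hn'
  have h1 : ∫⁻ e, f e = ∫⁻ y : E3, g ((√n)⁻¹ • y) := by
    have := lintegral_eq_lintegral_lintegral_orthogonal (closedPolygons n) (diagIsometry hn)
      (fun w hw y => by
        rw [diagIsometry_apply, inner_diag, (show endToEnd n w = 0 from hw), inner_zero_left])
      (by rw [finrank_euclideanSpace_fin, hdim, finrank_arm]) hf
    simp_rw [diagIsometry_apply, hdim'] at this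
    exact this
  -- The isometric parameter scales by `1/√n` and the end-to-end parameter by `1/n`; the factors
  -- `n^(3/2)` and `n^3` differ by the Jacobian `n^(3/2)`.
  have h2 := lintegral_comp_smul_of_pos (inv_pos.2 hs) hg
  have h3 := lintegral_comp_smul_of_pos (inv_pos.2 hn') hg
  change _ = _ * ∫⁻ y : E3, g ((n : ℝ)⁻¹ • y)
  rw [h1, h2, h3, ← mul_assoc, normalJacobian_endToEnd, ← ENNReal.ofReal_inv_of_pos (by positivity),
    ← ENNReal.ofReal_mul (by positivity)]
  congr 2
  rw [← inv_pow, ← inv_pow, inv_inv, inv_inv, Real.sqrt_eq_rpow, ← Real.rpow_natCast,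
    ← Real.rpow_natCast, ← Real.rpow_mul hn'.le, ← Real.rpow_neg hn'.le, ← Real.rpow_add hn']
  norm_num

theorem isAddHaarMeasure_submodule {V : Type*} [NormedAddCommGroup V]
    [InnerProductSpace ℝ V] [FiniteDimensional ℝ V] [MeasurableSpace V] [BorelSpace V]
    (K : Submodule ℝ V) : Measure.IsAddHaarMeasure
      (Measure.euclideanHausdorffMeasure (Module.finrank ℝ K) : Measure K) := by
  rw [InnerProductSpace.euclideanHausdorffMeasure_eq_volume]
  infer_instance

/-- Translation invariance along `K` lets the base point of a fibre be chosen freely. -/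
theorem lintegral_submodule_add {V : Type*} [NormedAddCommGroup V]
    [InnerProductSpace ℝ V] [FiniteDimensional ℝ V] [MeasurableSpace V] [BorelSpace V]
    (K : Submodule ℝ V) (f : V → ℝ≥0∞) (u : V) (c : V) (hc : c ∈ K) :
    ∫⁻ w : K, f (w + u) ∂(Measure.euclideanHausdorffMeasure (Module.finrank ℝ K)) =
      ∫⁻ w : K, f (w + (c + u)) ∂(Measure.euclideanHausdorffMeasure (Module.finrank ℝ K)) := by
  have := isAddHaarMeasure_submodule K
  rw [← lintegral_add_right_eq_self (fun w : K => f (w + u)) (⟨c, hc⟩ : K)]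
  simp [add_assoc]

/-! ### The Green's function as a mixture of heat kernels. -/

theorem measurable_ofReal_heat_comp {α : Type*} [MeasurableSpace α] {f : α → ℝ} {g : α → E3}
    (hf : Measurable f) (hg : Measurable g) :
    Measurable fun a => ENNReal.ofReal (heat (f a) (g a)) :=
  measurable_ofReal_heat.comp (hf.prodMk hg)

/-- A shift proportional to `t` makes the coefficient of the cross term independent of `t`; summed
over the edges of a closed polygon, the cross terms cancel. -/
theorem heat_add_smul {t σ : ℝ} (ht : 0 < t) (hσ : 0 < σ) (w y : E3) :
    heat t (w + (t / σ) • y) =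
      heat t w * Real.exp (-(8 * σ)⁻¹ * inner ℝ w y - (16 * σ ^ 2)⁻¹ * ‖y‖ ^ 2 * t) := by
  rw [heat, heat, mul_assoc _ (Real.exp _) (Real.exp _), ← Real.exp_add, norm_add_sq_real,
    norm_smul, mul_pow, Real.norm_eq_abs, sq_abs, inner_smul_right]
  congr 2
  field_simp
  ring

theorem prod_heat_add_smul {n : ℕ} {t : Fin n → ℝ} (ht : ∀ i, 0 < t i) (hσ : 0 < ∑ i, t i)
    {w : Arm n} (hw : w ∈ closedPolygons n) (y : E3) :
    ∏ i, heat (t i) (w i + (t i / ∑ j, t j) • y) =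
      (∏ i, heat (t i) (w i)) * Real.exp (-(16 * ∑ i, t i)⁻¹ * ‖y‖ ^ 2) := by
  simp_rw [fun i => heat_add_smul (ht i) hσ]
  rw [Finset.prod_mul_distrib, ← Real.exp_sum, Finset.sum_sub_distrib, ← Finset.mul_sum,
    ← Finset.mul_sum, ← sum_inner, mem_closedPolygons.1 hw, inner_zero_left]
  congr 2
  field_simp
  ring

/-- The heat kernels of the edges, integrated over the arms with a given end-to-end vector,
convolve to a single heat kernel. -/
theorem lintegral_closedPolygons_prod_heat {n : ℕ} (hn : 1 ≤ n) {t : Fin n → ℝ}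
    (ht : ∀ i, 0 < t i) (y : E3) :
    (ENNReal.ofReal (normalJacobian (endToEnd n)))⁻¹ *
      (∫⁻ w : closedPolygons n,
        ∏ i, ENNReal.ofReal (heat (t i) (((w : Arm n) + diag n ((n : ℝ)⁻¹ • y)) i))
        ∂(Measure.euclideanHausdorffMeasure (3 * n - 3))) =
      ENNReal.ofReal (heat (∑ i, t i) y) := by
  have hn' : (0 : ℝ) < n := by exact_mod_cast hn
  have hdim := finrank_closedPolygons hn
  have hdim' : Module.finrank ℝ (closedPolygons n) = 3 * n - 3 := by omega
  have hσ : 0 < ∑ i, t i := Finset.sum_pos (fun i _ => ht i) ⟨⟨0, hn⟩, Finset.mem_univ _⟩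
  set σ := ∑ i, t i with hσdef
  let f : Arm n → ℝ≥0∞ := fun e => ∏ i, ENNReal.ofReal (heat (t i) (e i))
  have hmeas : ∀ i, Measurable fun x : E3 => ENNReal.ofReal (heat (t i) x) := fun i =>
    measurable_ofReal_heat_comp measurable_const measurable_id
  have hf : Measurable f :=
    Finset.measurable_prod _ fun i _ => (hmeas i).comp (measurable_eval n i)
  let A : ℝ≥0∞ := (ENNReal.ofReal (normalJacobian (endToEnd n)))⁻¹
  let I : ℝ≥0∞ := ∫⁻ w : closedPolygons n, f w ∂(Measure.euclideanHausdorffMeasure (3 * n - 3))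
  have hslice : ∀ y : E3, ∫⁻ w : closedPolygons n, f (w + diag n ((n : ℝ)⁻¹ • y))
      ∂(Measure.euclideanHausdorffMeasure (3 * n - 3)) =
      ENNReal.ofReal (Real.exp (-(16 * σ)⁻¹ * ‖y‖ ^ 2)) * I := by
    intro y
    -- The base point where the product of kernels is largest on the fibre: each edge takes its
    -- share `t i / σ` of `y`.
    let v : Arm n := WithLp.toLp 2 fun i => (t i / σ) • y
    have hv : v - diag n ((n : ℝ)⁻¹ • y) ∈ closedPolygons n := by
      rw [mem_closedPolygons]
      change ∑ i, ((t i / σ) • y - (n : ℝ)⁻¹ • y) = 0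
      rw [Finset.sum_sub_distrib, ← Finset.sum_smul, ← Finset.sum_div, ← hσdef, div_self hσ.ne',
        Finset.sum_const, Finset.card_univ, Fintype.card_fin, ← Nat.cast_smul_eq_nsmul ℝ, smul_smul,
        mul_inv_cancel₀ hn'.ne', sub_self]
    have h1 := lintegral_submodule_add (closedPolygons n) f (diag n ((n : ℝ)⁻¹ • y)) _ hv
    rw [hdim'] at h1
    rw [h1, sub_add_cancel, ← lintegral_const_mul' _ _ ENNReal.ofReal_ne_top]
    refine lintegral_congr fun w => ?_
    change ∏ i, ENNReal.ofReal (heat (t i) ((w : Arm n) i + (t i / σ) • y)) =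
      _ * ∏ i, ENNReal.ofReal (heat (t i) ((w : Arm n) i))
    rw [← ENNReal.ofReal_prod_of_nonneg fun i _ => heat_nonneg (ht i) _,
      ← ENNReal.ofReal_prod_of_nonneg fun i _ => heat_nonneg (ht i) _,
      prod_heat_add_smul ht hσ w.2, mul_comm, ENNReal.ofReal_mul (by positivity)]
  -- The constant `I` is never computed directly: integrating over all `y` must give total mass one.
  have htot : A * I * ENNReal.ofReal ((16 * Real.pi * σ) ^ (3 / 2 : ℝ)) = 1 := by
    have h1 := lintegral_arm_eq_lintegral_closedPolygons hn hf
    simp_rw [hslice] at h1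
    rw [lintegral_arm_prod hmeas, lintegral_mul_const _ (by fun_prop),
      lintegral_exp_neg_mul_sq_norm (by positivity), finrank_euclideanSpace_fin] at h1
    simp_rw [fun i => lintegral_heat (ht i)] at h1
    rw [Finset.prod_const_one] at h1
    rw [h1, mul_assoc, mul_comm I]
    have : Real.pi / (16 * σ)⁻¹ = 16 * Real.pi * σ := by field_simp
    rw [this]
    norm_num
    rfl
  have hAI : A * I = ENNReal.ofReal ((16 * Real.pi * σ) ^ (-(3 / 2) : ℝ)) := by
    rw [ENNReal.eq_inv_of_mul_eq_one_left htot, ← ENNReal.ofReal_inv_of_pos (by positivity),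
      Real.rpow_neg (by positivity)]
  change A * ∫⁻ w : closedPolygons n, f (w + diag n ((n : ℝ)⁻¹ • y))
      ∂(Measure.euclideanHausdorffMeasure (3 * n - 3)) = _
  rw [hslice, mul_left_comm, hAI, heat, mul_comm, ENNReal.ofReal_mul (by positivity)]

/-- The mixture of heat kernels which is the Green's function of `n`-edge arms. -/
noncomputable def green (n : ℕ) (y : E3) : ℝ≥0∞ :=
  ∫⁻ t : Fin n → ℝ, ENNReal.ofReal (heat (∑ i, t i) y) ∂(Measure.pi fun _ => expLaw)

theorem armDensity_eq (n : ℕ) (e : Arm n) : armDensity n e =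
    ∫⁻ t : Fin n → ℝ, ∏ i, ENNReal.ofReal (heat (t i) (e i)) ∂(Measure.pi fun _ => expLaw) := by
  rw [lintegral_pi_prod expLaw (f := fun i t => ENNReal.ofReal (heat t (e i))) fun i =>
    measurable_ofReal_heat_comp measurable_id measurable_const]
  rfl

/-- The density of arms, integrated over the arms with a given end-to-end vector. -/
theorem lintegral_closedPolygons_armDensity {n : ℕ} (hn : 1 ≤ n) (y : E3) :
    (ENNReal.ofReal (normalJacobian (endToEnd n)))⁻¹ *
      (∫⁻ w : closedPolygons n, armDensity n (w + diag n ((n : ℝ)⁻¹ • y))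
        ∂(Measure.euclideanHausdorffMeasure (3 * n - 3))) = green n y := by
  have hdim := finrank_closedPolygons hn
  have hdim' : Module.finrank ℝ (closedPolygons n) = 3 * n - 3 := by omega
  have hsf : SFinite (Measure.euclideanHausdorffMeasure (3 * n - 3) :
      Measure (closedPolygons n)) := by
    rw [← hdim']
    have := sigmaFinite_euclideanHausdorffMeasure (closedPolygons n)
    infer_instance
  have hJ : (ENNReal.ofReal (normalJacobian (endToEnd n)))⁻¹ ≠ ∞ := by
    rw [normalJacobian_endToEnd, ENNReal.inv_ne_top]
    have : (0 : ℝ) < n := by exact_mod_cast hn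
    exact (ENNReal.ofReal_pos.2 (by positivity)).ne'
  simp_rw [armDensity_eq]
  rw [lintegral_lintegral_swap, ← lintegral_const_mul' _ _ hJ, green]
  · refine lintegral_congr_ae ?_
    filter_upwards [ae_pi_expLaw_pos n] with t ht
    exact lintegral_closedPolygons_prod_heat hn ht y
  · have hm : ∀ i, Measurable fun q : closedPolygons n × (Fin n → ℝ) =>
        ((q.1 : Arm n) + diag n ((n : ℝ)⁻¹ • y)) i := fun i =>
      (measurable_eval n i).comp ((measurable_subtype_coe.comp measurable_fst).add measurable_const)
    exact (Finset.measurable_prod Finset.univ fun i _ => measurable_ofReal_heat_comp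
      ((measurable_pi_apply i).comp measurable_snd) (hm i)).aemeasurable

theorem measurable_endToEnd (n : ℕ) : Measurable (endToEnd n) :=
  Finset.measurable_sum Finset.univ fun i _ => measurable_eval n i

theorem map_endToEnd_hopfGaussian {n : ℕ} (hn : 1 ≤ n) :
    (hopfGaussian n).map (endToEnd n) = (volume : Measure E3).withDensity (green n) := by
  have hJ : (ENNReal.ofReal (normalJacobian (endToEnd n)))⁻¹ ≠ ∞ := by
    rw [normalJacobian_endToEnd, ENNReal.inv_ne_top]
    have : (0 : ℝ) < n := by exact_mod_cast hn
    exact (ENNReal.ofReal_pos.2 (by positivity)).ne'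
  have hn' : (n : ℝ) ≠ 0 := by positivity
  rw [hopfGaussian_eq_withDensity]
  ext s hs
  have hs' := measurable_endToEnd n hs
  rw [Measure.map_apply (measurable_endToEnd n) hs, withDensity_apply _ hs', withDensity_apply _ hs,
    ← lintegral_indicator hs', ← lintegral_indicator hs,
    lintegral_arm_eq_lintegral_closedPolygons hn ((measurable_armDensity n).indicator hs'),
    ← lintegral_const_mul' _ _ hJ]
  refine lintegral_congr fun y => ?_
  have hmem : ∀ w : closedPolygons n,
      endToEnd n (w + diag n ((n : ℝ)⁻¹ • y)) = y := fun w => by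
    rw [map_add, endToEnd_diag, (show endToEnd n w = 0 from w.2), zero_add, smul_smul,
      mul_inv_cancel₀ hn', one_smul]
  by_cases hy : y ∈ s
  · rw [Set.indicator_of_mem hy, ← lintegral_closedPolygons_armDensity hn y]
    congr 1
    refine lintegral_congr fun w => Set.indicator_of_mem ?_ _
    rw [Set.mem_preimage, hmem]; exact hy
  · rw [Set.indicator_of_notMem hy]
    have : ∀ w : closedPolygons n, (endToEnd n ⁻¹' s).indicator (armDensity n)
        (w + diag n ((n : ℝ)⁻¹ • y)) = 0 := fun w => Set.indicator_of_notMem (by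
      rw [Set.mem_preimage, hmem]; exact hy) _
    simp_rw [this]
    simp

theorem codimThreeMeasure_armDensity {n : ℕ} (hn : 1 ≤ n) :
    codimThreeMeasure n (armDensity n) (closedPolygons n) = green n 0 := by
  have hK : MeasurableSet (closedPolygons n : Set (Arm n)) :=
    measurable_endToEnd n (measurableSet_singleton 0)
  rw [← lintegral_closedPolygons_armDensity hn 0, codimThreeMeasure, Measure.smul_apply,
    withDensity_apply _ hK, Measure.restrict_restrict hK, Set.inter_self,
    ← map_subtype_euclideanHausdorffMeasure,
    lintegral_map (measurable_armDensity n) measurable_subtype_coe]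
  simp

/-! ### Continuity of the densities. -/

theorem heat_le_heat {t : ℝ} (ht : 0 < t) {y z : E3} (h : ‖y‖ ≤ ‖z‖) : heat t z ≤ heat t y := by
  unfold heat
  have h2 : ‖y‖ ^ 2 ≤ ‖z‖ ^ 2 := pow_le_pow_left₀ (norm_nonneg _) h 2
  have h3 : (0 : ℝ) < (16 * t)⁻¹ := by positivity
  gcongr _ * Real.exp ?_
  nlinarith

theorem continuous_heat (t : ℝ) : Continuous (heat t) := by
  unfold heat; fun_prop

/-- A mixture of heat kernels which is finite off the origin is continuous, with a possible pole at
the origin. -/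
theorem continuous_lintegral_heat {α : Type*} [MeasurableSpace α] {μ : Measure α} {s : α → ℝ}
    (hs : Measurable s) (hpos : ∀ᵐ a ∂μ, 0 < s a)
    (hfin : ∀ y : E3, y ≠ 0 → ∫⁻ a, ENNReal.ofReal (heat (s a) y) ∂μ ≠ ∞) :
    Continuous fun y : E3 => ∫⁻ a, ENNReal.ofReal (heat (s a) y) ∂μ := by
  have hm : ∀ y : E3, Measurable fun a => ENNReal.ofReal (heat (s a) y) := fun y =>
    measurable_ofReal_heat_comp hs measurable_const
  have hlim : ∀ (y : E3) (a : α), Filter.Tendsto (fun z => ENNReal.ofReal (heat (s a) z)) (nhds y)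
      (nhds (ENNReal.ofReal (heat (s a) y))) := fun y a =>
    (ENNReal.continuous_ofReal.comp (continuous_heat (s a))).tendsto y
  have hle : ∀ y z : E3, ‖y‖ ≤ ‖z‖ → ∀ᵐ a ∂μ,
      ENNReal.ofReal (heat (s a) z) ≤ ENNReal.ofReal (heat (s a) y) := fun y z h => by
    filter_upwards [hpos] with a ha using ENNReal.ofReal_le_ofReal (heat_le_heat ha h)
  refine continuous_iff_continuousAt.2 fun y => ?_
  by_cases hy : y = 0
  · subst hy
    -- At the origin the value may be `∞`: Fatou bounds the limit below, and maximality of each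
    -- kernel at `0` bounds it above.
    refine tendsto_of_le_liminf_of_limsup_le ?_ ?_
    · refine le_trans (lintegral_mono fun a => ?_) (lintegral_liminf_le hm)
      exact (hlim 0 a).liminf_eq.ge
    · refine Filter.limsup_le_of_le (by isBoundedDefault) (Filter.Eventually.of_forall fun z => ?_)
      exact lintegral_mono_ae (hle 0 z (by simp))
  · have hy' : 0 < ‖y‖ := norm_pos_iff.2 hy
    -- Points near `y` have norm above `‖y‖ / 2`, so the kernel at `y / 2` dominates.
    refine tendsto_lintegral_filter_of_dominated_convergence
      (fun a => ENNReal.ofReal (heat (s a) ((1 / 2 : ℝ) • y))) (Filter.Eventually.of_forall hm) ?_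
      (hfin _ (smul_ne_zero (by norm_num) hy)) (ae_of_all _ (hlim y))
    have : ∀ᶠ z in nhds y, ‖y‖ / 2 < ‖z‖ :=
      continuous_norm.continuousAt.eventually (lt_mem_nhds (half_lt_self hy'))
    filter_upwards [this] with z hz
    refine hle _ _ ?_
    rw [norm_smul]
    norm_num
    linarith

/-- A bound uniform in `t`, so the mixture is finite off the origin. With `v = 1/(16πt)` and `b =
π‖x‖²` it follows from `v^(3/2) ≤ 1 + v²` and the quadratic lower bound for `exp (v b)`. -/
theorem heat_le {t : ℝ} (ht : 0 < t) {x : E3} (hx : x ≠ 0) :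
    heat t x ≤ 1 + 2 / (Real.pi * ‖x‖ ^ 2) ^ 2 := by
  have hr : 0 < ‖x‖ ^ 2 := by positivity
  set r := ‖x‖ ^ 2
  set v := (16 * Real.pi * t)⁻¹ with hv
  have hv0 : 0 < v := by positivity
  have hvr : (16 * t)⁻¹ * r = v * (Real.pi * r) := by rw [hv]; field_simp
  have hpr : 0 < Real.pi * r := by positivity
  set b := Real.pi * r
  have h1 : heat t x = v ^ (3 / 2 : ℝ) * Real.exp (-(v * b)) := by
    rw [heat, Real.rpow_neg (by positivity), ← Real.inv_rpow (by positivity), neg_mul, hvr]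
  have h2 : v ^ (3 / 2 : ℝ) ≤ 1 + v ^ 2 := by
    rcases le_total v 1 with h | h
    · have := Real.rpow_le_one hv0.le h (show (0 : ℝ) ≤ 3 / 2 by norm_num)
      nlinarith [sq_nonneg v]
    · have := Real.rpow_le_rpow_of_exponent_le h (show (3 / 2 : ℝ) ≤ (2 : ℕ) by norm_num)
      rw [Real.rpow_natCast] at this
      linarith
  have h3 := Real.quadratic_le_exp_of_nonneg (show 0 ≤ v * b by positivity)
  rw [h1, Real.exp_neg, ← div_eq_mul_inv, div_le_iff₀ (Real.exp_pos _)]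
  have h4 : v ^ 2 = 2 / b ^ 2 * ((v * b) ^ 2 / 2) := by field_simp
  have h5 : 0 < 2 / b ^ 2 := by positivity
  have h6 : 0 < v * b := by positivity
  calc v ^ (3 / 2 : ℝ) ≤ 1 + 2 / b ^ 2 * ((v * b) ^ 2 / 2) := by rw [← h4]; exact h2
    _ ≤ 1 * Real.exp (v * b) + 2 / b ^ 2 * Real.exp (v * b) := by
      gcongr
      · nlinarith [sq_nonneg (v * b)]
      · nlinarith [sq_nonneg (v * b)]
    _ = _ := by ring

theorem continuous_edgeDensity : Continuous edgeDensity := by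
  refine continuous_lintegral_heat measurable_id ae_expLaw_pos fun x hx => ?_
  refine ((lintegral_mono_ae (g := fun _ => ENNReal.ofReal (1 + 2 / (Real.pi * ‖x‖ ^ 2) ^ 2))
    ?_).trans_lt ?_).ne
  · filter_upwards [ae_expLaw_pos] with t ht using ENNReal.ofReal_le_ofReal (heat_le ht hx)
  · simp

/-- Multiplication on `[0, ∞]` is discontinuous at `(0, ∞)`; since edge densities can be `∞`, their
products are continuous because none vanishes. -/
theorem edgeDensity_ne_zero (x : E3) : edgeDensity x ≠ 0 := by
  intro h
  rw [edgeDensity, lintegral_eq_zero_iff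
    (measurable_ofReal_heat_comp measurable_id' measurable_const)] at h
  obtain ⟨t, ht, ht'⟩ := (h.and ae_expLaw_pos).exists
  exact (ENNReal.ofReal_pos.2 (heat_pos ht' x)).ne' ht

theorem tendsto_finset_prod_of_ne_zero {ι X : Type*} {l : Filter X} (s : Finset ι)
    {f : ι → X → ℝ≥0∞} {a : ι → ℝ≥0∞} (h : ∀ i, Filter.Tendsto (f i) l (nhds (a i)))
    (ha : ∀ i, a i ≠ 0) :
    Filter.Tendsto (fun x => ∏ i ∈ s, f i x) l (nhds (∏ i ∈ s, a i)) := by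
  induction s using Finset.cons_induction with
  | empty => simpa using tendsto_const_nhds
  | cons i s hi ih =>
    simp_rw [Finset.prod_cons]
    exact ENNReal.Tendsto.mul (h i) (Or.inl (ha i)) ih
      (Or.inl (Finset.prod_ne_zero_iff.2 fun j _ => ha j))

theorem continuous_armDensity (n : ℕ) : Continuous (armDensity n) :=
  continuous_iff_continuousAt.2 fun e => tendsto_finset_prod_of_ne_zero Finset.univ
    (fun i => (continuous_edgeDensity.comp (PiLp.continuous_apply 2 _ i)).tendsto e)
    fun i => edgeDensity_ne_zero (e i)

/-! ### The value at the origin. -/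

/-- Euler's Beta integral: write `(1 + u)^(-b)` as a Gamma integral in `v` and integrate over `u`
first. -/
theorem lintegral_rpow_mul_one_add_rpow_neg {a b : ℝ} (ha : 0 < a) (hab : a < b) :
    ∫⁻ u in Set.Ioi (0 : ℝ), ENNReal.ofReal (u ^ (a - 1) * (1 + u) ^ (-b)) =
      ENNReal.ofReal (Real.Gamma a * Real.Gamma (b - a) / Real.Gamma b) := by
  have hb : 0 < b := ha.trans hab
  have hGa := Real.Gamma_pos_of_pos ha
  have hGb := Real.Gamma_pos_of_pos hb
  have h1 : ∀ u ∈ Set.Ioi (0 : ℝ), ENNReal.ofReal (u ^ (a - 1) * (1 + u) ^ (-b)) =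
      ENNReal.ofReal (Real.Gamma b)⁻¹ * ∫⁻ v in Set.Ioi (0 : ℝ), ENNReal.ofReal
        (v ^ (b - 1) * Real.exp (-v) * (u ^ (a - 1) * Real.exp (-(v * u)))) := by
    intro u hu
    have hu' : (0 : ℝ) < u := hu
    have h := lintegral_rpow_mul_exp_neg_mul hb (show 0 < 1 + u by linarith)
    have h' : ∀ v : ℝ, ENNReal.ofReal
        (v ^ (b - 1) * Real.exp (-v) * (u ^ (a - 1) * Real.exp (-(v * u)))) =
        ENNReal.ofReal (u ^ (a - 1)) *
          ENNReal.ofReal (v ^ (b - 1) * Real.exp (-((1 + u) * v))) := by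
      intro v
      rw [← ENNReal.ofReal_mul (by positivity), show -((1 + u) * v) = -v + -(v * u) by ring,
        Real.exp_add]
      congr 1
      ring
    simp_rw [h']
    rw [lintegral_const_mul' _ _ ENNReal.ofReal_ne_top, h, ← ENNReal.ofReal_mul (by positivity),
      ← ENNReal.ofReal_mul (by positivity)]
    congr 1
    field_simp
  have h2 : ∀ v ∈ Set.Ioi (0 : ℝ), (∫⁻ u in Set.Ioi (0 : ℝ), ENNReal.ofReal
        (v ^ (b - 1) * Real.exp (-v) * (u ^ (a - 1) * Real.exp (-(v * u))))) =
      ENNReal.ofReal (Real.Gamma a) *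
        ENNReal.ofReal (v ^ ((b - a) - 1) * Real.exp (-(1 * v))) := by
    intro v hv
    have hv' : (0 : ℝ) < v := hv
    simp_rw [ENNReal.ofReal_mul (show 0 ≤ v ^ (b - 1) * Real.exp (-v) by positivity)]
    rw [lintegral_const_mul' _ _ ENNReal.ofReal_ne_top, lintegral_rpow_mul_exp_neg_mul ha hv',
      ← ENNReal.ofReal_mul (by positivity), ← ENNReal.ofReal_mul (by positivity)]
    congr 1
    rw [show b - a - 1 = (b - 1) + -a by ring, Real.rpow_add hv', one_mul]
    ring
  rw [setLIntegral_congr_fun measurableSet_Ioi h1, lintegral_const_mul' _ _ ENNReal.ofReal_ne_top,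
    lintegral_lintegral_swap (by fun_prop), setLIntegral_congr_fun measurableSet_Ioi h2,
    lintegral_const_mul' _ _ ENNReal.ofReal_ne_top,
    lintegral_rpow_mul_exp_neg_mul (by linarith) one_pos, ← ENNReal.ofReal_mul (by positivity),
    ← ENNReal.ofReal_mul (by positivity)]
  congr 1
  rw [Real.one_rpow]
  field_simp

/-- A negative moment of a sum of independent unit-rate exponential variables. -/
theorem lintegral_sum_rpow_neg_expLaw {n : ℕ} {a : ℝ} (ha : 0 < a) (han : a < n) :
    ∫⁻ t : Fin n → ℝ, ENNReal.ofReal ((∑ i, t i) ^ (-a)) ∂(Measure.pi fun _ => expLaw) =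
      ENNReal.ofReal (Real.Gamma (n - a) / Real.Gamma n) := by
  have hn : 0 < n := by
    have : (0 : ℝ) < n := ha.trans han
    exact_mod_cast this
  have hGa := Real.Gamma_pos_of_pos ha
  -- Writing the power as a Gamma integral in `u` turns the moment into the Laplace transform of the
  -- sum, which by independence is `(1 + u)^(-n)`.
  have h1 : ∀ᵐ t ∂(Measure.pi fun _ : Fin n => expLaw),
      ENNReal.ofReal ((∑ i, t i) ^ (-a)) = ENNReal.ofReal (Real.Gamma a)⁻¹ *
        ∫⁻ u in Set.Ioi (0 : ℝ), ENNReal.ofReal (u ^ (a - 1) * Real.exp (-((∑ i, t i) * u))) := by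
    filter_upwards [ae_pi_expLaw_pos n] with t ht
    have hσ : 0 < ∑ i, t i := Finset.sum_pos (fun i _ => ht i) ⟨⟨0, hn⟩, Finset.mem_univ _⟩
    rw [lintegral_rpow_mul_exp_neg_mul ha hσ, ← ENNReal.ofReal_mul (by positivity),
      inv_mul_cancel_left₀ hGa.ne']
  have h2 : ∀ u ∈ Set.Ioi (0 : ℝ), (∫⁻ t : Fin n → ℝ,
      ENNReal.ofReal (u ^ (a - 1) * Real.exp (-((∑ i, t i) * u)))
        ∂(Measure.pi fun _ => expLaw)) = ENNReal.ofReal (u ^ (a - 1) * (1 + u) ^ (-(n : ℝ))) := by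
    intro u hu
    have hu' : (0 : ℝ) < u := hu
    have e : ∀ t : Fin n → ℝ, ENNReal.ofReal (u ^ (a - 1) * Real.exp (-((∑ i, t i) * u))) =
        ENNReal.ofReal (u ^ (a - 1)) * ∏ i, ENNReal.ofReal (Real.exp (-(u * t i))) := by
      intro t
      rw [← ENNReal.ofReal_prod_of_nonneg (fun _ _ => by positivity), ← Real.exp_sum,
        Finset.sum_neg_distrib, ← Finset.mul_sum, mul_comm u, ENNReal.ofReal_mul (by positivity)]
    simp_rw [e]
    rw [lintegral_const_mul' _ _ ENNReal.ofReal_ne_top,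
      lintegral_pi_prod expLaw (f := fun _ t => ENNReal.ofReal (Real.exp (-(u * t))))
        (fun _ => by fun_prop), lintegral_exp_neg_mul_expLaw hu'.le, Finset.prod_const,
      Finset.card_univ, Fintype.card_fin, ← ENNReal.ofReal_pow (by positivity),
      ← ENNReal.ofReal_mul (by positivity), Real.rpow_neg (by positivity), Real.rpow_natCast,
      inv_pow]
  rw [lintegral_congr_ae h1, lintegral_const_mul' _ _ ENNReal.ofReal_ne_top,
    lintegral_lintegral_swap (by fun_prop), setLIntegral_congr_fun measurableSet_Ioi h2,
    lintegral_rpow_mul_one_add_rpow_neg ha han, ← ENNReal.ofReal_mul (by positivity)]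
  congr 1
  field_simp

theorem green_zero {n : ℕ} (hn : 2 ≤ n) :
    green n 0 = ENNReal.ofReal
      (Real.Gamma ((n : ℝ) - 3 / 2) / (64 * Real.pi ^ (3 / 2 : ℝ) * Real.Gamma (n : ℝ))) := by
  have hn' : (2 : ℝ) ≤ n := by exact_mod_cast hn
  have h : ∀ᵐ t ∂(Measure.pi fun _ : Fin n => expLaw),
      ENNReal.ofReal (heat (∑ i, t i) 0) = ENNReal.ofReal ((16 * Real.pi) ^ (-(3 / 2) : ℝ)) *
        ENNReal.ofReal ((∑ i, t i) ^ (-(3 / 2) : ℝ)) := by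
    filter_upwards [ae_pi_expLaw_pos n] with t ht
    have hσ : 0 ≤ ∑ i, t i := Finset.sum_nonneg fun i _ => (ht i).le
    rw [heat, Real.mul_rpow (by positivity) hσ, ← ENNReal.ofReal_mul (by positivity)]
    simp
  rw [green, lintegral_congr_ae h, lintegral_const_mul' _ _ ENNReal.ofReal_ne_top,
    lintegral_sum_rpow_neg_expLaw (by norm_num) (by linarith), ← ENNReal.ofReal_mul (by positivity)]
  congr 1
  have h16 : (16 : ℝ) ^ (3 / 2 : ℝ) = 64 := by
    rw [show (16 : ℝ) = 4 ^ (2 : ℝ) by norm_num, ← Real.rpow_mul (by norm_num)]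
    norm_num
  rw [Real.rpow_neg (by positivity), Real.mul_rpow (by norm_num) Real.pi_pos.le, h16]
  field_simp

/-- For `n ≥ 2` the pole has disappeared: the value at the origin is finite and bounds all others.
-/
theorem continuous_green {n : ℕ} (hn : 2 ≤ n) : Continuous (green n) := by
  have hpos : ∀ᵐ t ∂(Measure.pi fun _ : Fin n => expLaw), 0 < ∑ i, t i := by
    filter_upwards [ae_pi_expLaw_pos n] with t ht
    exact Finset.sum_pos (fun i _ => ht i) ⟨⟨0, by omega⟩, Finset.mem_univ _⟩
  refine continuous_lintegral_heat (by fun_prop) hpos fun y _ => ?_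
  refine ((lintegral_mono_ae (g := fun t => ENNReal.ofReal (heat (∑ i, t i) 0)) ?_).trans_lt ?_).ne
  · filter_upwards [hpos] with t ht using
      ENNReal.ofReal_le_ofReal (heat_le_heat ht (by simp))
  · change green n 0 < ∞
    rw [green_zero hn]
    exact ENNReal.ofReal_lt_top

/-! ### Uniqueness and conclusion. -/

/-- Finite mass determines the density almost everywhere; as open sets have positive volume,
continuity upgrades this to equality. -/
theorem IsContinuousDensity.unique {E : Type*} [TopologicalSpace E] [MeasureSpace E]
    [OpensMeasurableSpace E] [(volume : Measure E).IsOpenPosMeasure] {μ : Measure E}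
    [IsFiniteMeasure μ] {p q : E → ℝ≥0∞} (hp : IsContinuousDensity μ p)
    (hq : IsContinuousDensity μ q) : p = q := by
  have hfin : ∫⁻ x, p x ≠ ∞ := by
    rw [← setLIntegral_univ, ← withDensity_apply _ MeasurableSet.univ, ← hp.2]
    exact measure_ne_top μ _
  have h := (withDensity_eq_iff hp.1.measurable.aemeasurable hq.1.measurable.aemeasurable hfin).1
    (hp.2.symm.trans hq.2)
  exact Continuous.ae_eq_iff_eq volume hp.1 hq.1 |>.1 h

instance (n : ℕ) : IsProbabilityMeasure (hopfGaussian n) :=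
  have : IsProbabilityMeasure (gaussianH n) := by unfold gaussianH; infer_instance
  Measure.isProbabilityMeasure_map (measurable_hopfArm n).aemeasurable

end HopfGaussian

theorem proposition7 (n : ℕ) (hn : 2 ≤ n) :
    (∃! p : HopfGaussian.Arm n → ENNReal,
      HopfGaussian.IsContinuousDensity (HopfGaussian.hopfGaussian n) p) ∧
    (∃! G : HopfGaussian.E3 → ENNReal, HopfGaussian.IsGreenFunction n G) ∧
    ∀ (p : HopfGaussian.Arm n → ENNReal) (G : HopfGaussian.E3 → ENNReal),
      HopfGaussian.IsContinuousDensity (HopfGaussian.hopfGaussian n) p →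
      HopfGaussian.IsGreenFunction n G →
      HopfGaussian.codimThreeMeasure n p (HopfGaussian.closedPolygons n) = G 0 ∧
      G 0 = ENNReal.ofReal
        (Real.Gamma ((n : ℝ) - 3 / 2) / (64 * Real.pi ^ (3 / 2 : ℝ) * Real.Gamma (n : ℝ))) := by
  have hn1 : 1 ≤ n := by omega
  have hp₀ : HopfGaussian.IsContinuousDensity (HopfGaussian.hopfGaussian n)
      (HopfGaussian.armDensity n) :=
    ⟨HopfGaussian.continuous_armDensity n, HopfGaussian.hopfGaussian_eq_withDensity n⟩
  have hG₀ : HopfGaussian.IsGreenFunction n (HopfGaussian.green n) :=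
    ⟨HopfGaussian.continuous_green hn, HopfGaussian.map_endToEnd_hopfGaussian hn1⟩
  have hfin := Measure.isProbabilityMeasure_map (μ := HopfGaussian.hopfGaussian n)
    (HopfGaussian.measurable_endToEnd n).aemeasurable
  refine ⟨⟨_, hp₀, fun p hp => hp.unique hp₀⟩,
    ⟨_, hG₀, fun G hG => HopfGaussian.IsContinuousDensity.unique hG hG₀⟩, fun p G hp hG => ?_⟩
  rw [hp.unique hp₀, HopfGaussian.IsContinuousDensity.unique hG hG₀]
  exact ⟨HopfGaussian.codimThreeMeasure_armDensity hn1, HopfGaussian.green_zero hn⟩
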